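/- Let $\mathcal{H}$ be a finite-dimensional Hilbert space, $|\Psi\rangle\in\mathcal{H}$ a unit vector (the target state, for instance a qudit graph state), $0<\lambda<1$, $\nu:=1-\lambda$, and $\Omega:=|\Psi\rangle\langle\Psi|+\lambda(1-|\Psi\rangle\langle\Psi|)$, $\overline{\Omega}:=1-\Omega$. For integers $N\ge 1$ and $0\le k\le N-1$, and a permutation-invariant density operator $\rho$ on $\mathcal{H}^{\otimes(N+1)}$, let $$p_k(\rho):=\sum_{i=0}^k\binom{N}{i}\operatorname{tr}\bigl([\Omega^{\otimes(N-i)}\otimes\overline{\Omega}^{\otimes i}\otimes 1]\rho\bigr),\qquad f_k(\rho):=\sum_{i=0}^k\binom{N}{i}\operatorname{tr}\bigl([\Omega^{\otimes(N-i)}\otimes\overline{\Omega}^{\otimes i}\otimes|\Psi\rangle\langle\Psi|]\rho\bigr),$$ and $F_k(\rho):=f_k(\rho)/p_k(\rho)$ whenever $p_k(\rho)>0$. Thus $p_k(\rho)$ is the probability that at most $k$ of the $N$ tests fail, and $F_k(\rho)$ is the fidelity of the remaining system with the target, conditioned on this event. For $0<\delta\le1$ the guaranteed infidelity is $$\bar\epsilon_\lambda(k,N,\delta):=1-\min_\rho\{F_k(\rho)\mid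 p_k(\rho)\ge\delta\},$$ where $\rho$ ranges over all permutation-invariant density operators on $\mathcal{H}^{\otimes(N+1)}$. Suppose $0<\lambda<1$. (1) If $0\le s<\epsilon<1$, $0<\delta\le 1/2$, and the number $N$ of tests satisfies $$N\ \ge\ \frac{\epsilon}{[\lambda\nu(\epsilon-s)]^2}\,\bigl(\ln\delta^{-1}+4\lambda\nu^2\bigr),$$ then $\bar\epsilon_\lambda(\lfloor\nu sN\rfloor,N,\delta)\le\epsilon$. (2) Consequently, if the ratio $s/\epsilon$ is fixed, the sampling cost is $O(\epsilon^{-1}\ln\delta^{-1})$: for every $0\le c<1$ there is a constant $C>0$, depending only on $\lambda$ and $c$, such that for all $0<\epsilon<1$ and $0<\delta\le1/2$, with $s=c\,\epsilon$, there is an integer $N_0\ge1$ with $N_0\le C\,\epsilon^{-1}\ln\delta^{-1}$ such that $\bar\epsilon_\lambda(\lfloor\nu sN\rfloor,N,\delta)\le\epsilon$ for all $N\ge N_0$, for every finite-dimensional $\mathcal{H}$ and every unit vector $|\Psi\rangle$. -/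

import Mathlib

open scoped ComplexOrder

noncomputable section

namespace StateVerification

variable {ι : Type*} [Fintype ι] [DecidableEq ι]

/-- The rank-one operator `|Ψ⟩⟨Ψ|` on `ℂ^ι`, as a matrix in the standard basis. -/
def proj (Ψ : EuclideanSpace ℂ ι) : Matrix ι ι ℂ :=
  Matrix.of fun a b => Ψ a * star (Ψ b)

/-- The homogeneous verification operator `Ω = |Ψ⟩⟨Ψ| + lam (1 - |Ψ⟩⟨Ψ|)`. -/
def verificationOp (Ψ : EuclideanSpace ℂ ι) (lam : ℝ) : Matrix ι ι ℂ :=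
  proj Ψ + (lam : ℂ) • (1 - proj Ψ)

/-- The tensor product `A 0 ⊗ A 1 ⊗ ⋯ ⊗ A (m - 1)` of `m` operators on `H = ℂ^ι`, as an operator on
`H^{⊗ m}`, in the product basis, which is indexed by `Fin m → ι`. -/
def tensorOp {m : ℕ} (A : Fin m → Matrix ι ι ℂ) : Matrix (Fin m → ι) (Fin m → ι) ℂ :=
  Matrix.of fun x y => ∏ j, A j (x j) (y j)

/-- Density operators: positive semidefinite of trace one. -/
def IsDensityOp {κ : Type*} [Fintype κ] (ρ : Matrix κ κ ℂ) : Prop :=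
  ρ.PosSemidef ∧ ρ.trace = 1

/-- Invariance of an operator on `H^{⊗ m}` under conjugation by every permutation of the `m`
tensor factors. -/
def IsPermInvariant {m : ℕ} (ρ : Matrix (Fin m → ι) (Fin m → ι) ℂ) : Prop :=
  ∀ σ : Equiv.Perm (Fin m), ∀ x y : Fin m → ι, ρ (x ∘ σ) (y ∘ σ) = ρ x y

/-- The operator `Ω^{⊗ (N - i)} ⊗ (1 - Ω)^{⊗ i} ⊗ E` on `H^{⊗ (N + 1)}` (used for `i ≤ N`):
the first `N - i` tests are passed, the next `i` tests fail, and `E` acts on the last system. -/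
def testOp (Ψ : EuclideanSpace ℂ ι) (lam : ℝ) (N i : ℕ) (E : Matrix ι ι ℂ) :
    Matrix (Fin (N + 1) → ι) (Fin (N + 1) → ι) ℂ :=
  tensorOp fun j =>
    if (j : ℕ) < N - i then verificationOp Ψ lam
    else if (j : ℕ) < N then 1 - verificationOp Ψ lam
    else E

/-- `∑_{i=0}^{k} (N choose i) tr([Ω^{⊗ (N - i)} ⊗ (1 - Ω)^{⊗ i} ⊗ E] ρ)`. -/
def acceptWeight (Ψ : EuclideanSpace ℂ ι) (lam : ℝ) (k N : ℕ) (E : Matrix ι ι ℂ)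
    (ρ : Matrix (Fin (N + 1) → ι) (Fin (N + 1) → ι) ℂ) : ℝ :=
  ∑ i ∈ Finset.range (k + 1), (N.choose i : ℝ) * ((testOp Ψ lam N i E * ρ).trace).re

/-- The probability `p_k(ρ)` that at most `k` failures are observed among the `N` tests on a
permutation-invariant state `ρ`. -/
def acceptProb (Ψ : EuclideanSpace ℂ ι) (lam : ℝ) (k N : ℕ)
    (ρ : Matrix (Fin (N + 1) → ι) (Fin (N + 1) → ι) ℂ) : ℝ :=
  acceptWeight Ψ lam k N 1 ρ

/-- The fidelity `F_k(ρ) = f_k(ρ) / p_k(ρ)` between the target state and the reduced state of the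
last system, conditioned on at most `k` failures (meaningful when `p_k(ρ) > 0`). -/
def condFidelity (Ψ : EuclideanSpace ℂ ι) (lam : ℝ) (k N : ℕ)
    (ρ : Matrix (Fin (N + 1) → ι) (Fin (N + 1) → ι) ℂ) : ℝ :=
  acceptWeight Ψ lam k N (proj Ψ) ρ / acceptProb Ψ lam k N ρ

/-- The guaranteed infidelity `1 - min_ρ {F_k(ρ) | p_k(ρ) ≥ δ}`, over all permutation-invariant
density operators `ρ` on `H^{⊗ (N + 1)}`. -/
def guaranteedInfidelity (Ψ : EuclideanSpace ℂ ι) (lam : ℝ) (k N : ℕ) (δ : ℝ) : ℝ :=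
  1 - sInf {F : ℝ | ∃ ρ : Matrix (Fin (N + 1) → ι) (Fin (N + 1) → ι) ℂ,
    IsDensityOp ρ ∧ IsPermInvariant ρ ∧ δ ≤ acceptProb Ψ lam k N ρ ∧
      F = condFidelity Ψ lam k N ρ}

end StateVerification

end

/-! Write ν = 1 - lam and B j = `binomialCdf lam k j`. A permutation-invariant state enters only
through the law of the number j of erroneous systems (orthogonal to Ψ) among the N + 1. A correct
system never fails a test and an erroneous one fails with probability ν, so B j is the chance of at
most k failures when j tested systems are erroneous. Hence p and f are linear in the law of j.

The bound is then linear duality. If some η ≤ ε satisfies (1 - η) p - f ≤ (ε - η) δ for all laws,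
then p ≥ δ forces f ≥ (1 - ε) p. By linearity it suffices to test each fixed j, where the left side
times N + 1 is `excess`.

Monotone likelihood ratios make `excess` unimodal in j, so choosing η suitably places its maximum at
a prescribed n + 1 (`excess_le_of_stationary`, `exists_supporting_line`). It remains to find n with
B n ≤ δ such that n + 1 errors give conditional infidelity at most ε (`exists_threshold`). The first
condition, by Chernoff, wants n large; the second, by an upper bound on the hazard ν b / B with b
the binomial weight at k, wants n small. The hypothesis on N leaves room for an integer between
them, its summand 4 lam ν² paying for rounding and lower-order terms. -/

noncomputable section

namespace StateVerification

/-! ### Binomial weights and distribution functions -/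

/-- The probability that a binomial variable with `n` trials of success probability `1 - lam` takes
the value `i`. -/
def binomialWeight (lam : ℝ) (n i : ℕ) : ℝ :=
  (n.choose i : ℝ) * (1 - lam) ^ i * lam ^ (n - i)

/-- The probability that a binomial variable with `n` trials of success probability `1 - lam` takes
a value at most `k`. -/
def binomialCdf (lam : ℝ) (k n : ℕ) : ℝ :=
  ∑ i ∈ Finset.range (k + 1), binomialWeight lam n i

lemma binomialWeight_eq_zero {lam : ℝ} {n i : ℕ} (h : n < i) : binomialWeight lam n i = 0 := by
  simp [binomialWeight, Nat.choose_eq_zero_of_lt h]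

lemma binomialWeight_nonneg {lam : ℝ} (h0 : 0 < lam) (h1 : lam < 1) (n i : ℕ) :
    0 ≤ binomialWeight lam n i := by
  have : 0 < 1 - lam := by linarith
  unfold binomialWeight; positivity

lemma binomialWeight_pos {lam : ℝ} (h0 : 0 < lam) (h1 : lam < 1) {n i : ℕ} (h : i ≤ n) :
    0 < binomialWeight lam n i := by
  have : 0 < 1 - lam := by linarith
  have := Nat.choose_pos h
  unfold binomialWeight; positivity

lemma binomialCdf_pos {lam : ℝ} (h0 : 0 < lam) (h1 : lam < 1) (k n : ℕ) :
    0 < binomialCdf lam k n :=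
  Finset.sum_pos' (fun i _ => binomialWeight_nonneg h0 h1 n i)
    ⟨0, by simp, binomialWeight_pos h0 h1 (Nat.zero_le n)⟩

lemma binomialCdf_zero (lam : ℝ) (k : ℕ) : binomialCdf lam k 0 = 1 := by
  unfold binomialCdf
  rw [Finset.sum_range_succ', Finset.sum_eq_zero]
  · simp [binomialWeight]
  · intro i _
    exact binomialWeight_eq_zero (Nat.succ_pos i)

/-- The detailed balance relation between neighbouring binomial weights. -/
lemma sub_mul_binomialWeight (lam : ℝ) (n k : ℕ) :
    ((n : ℝ) - k) * ((1 - lam) * binomialWeight lam n k)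
      = lam * ((k + 1) * binomialWeight lam n (k + 1)) := by
  rcases lt_trichotomy n k with h | h | h
  · simp [binomialWeight_eq_zero h, binomialWeight_eq_zero (Nat.lt_succ_of_lt h)]
  · subst h
    simp [binomialWeight_eq_zero (Nat.lt_succ_self n)]
  · have hc : (n.choose (k + 1) : ℝ) * (k + 1) = n.choose k * ((n : ℝ) - k) := by
      have := Nat.choose_succ_right_eq n k
      rw [← Nat.cast_sub h.le]
      exact_mod_cast this
    obtain ⟨m, rfl⟩ := Nat.exists_eq_add_of_lt h
    have e1 : k + m + 1 - k = m + 1 := by omega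
    have e2 : k + m + 1 - (k + 1) = m := by omega
    simp only [binomialWeight, e1, e2]
    linear_combination (-(1 - lam) ^ (k + 1) * lam ^ (m + 1)) * hc

lemma binomialWeight_succ_zero (lam : ℝ) (n : ℕ) :
    binomialWeight lam (n + 1) 0 = lam * binomialWeight lam n 0 := by
  simp [binomialWeight, pow_succ, mul_comm]

lemma binomialWeight_succ_succ (lam : ℝ) (n i : ℕ) :
    binomialWeight lam (n + 1) (i + 1)
      = (1 - lam) * binomialWeight lam n i + lam * binomialWeight lam n (i + 1) := by
  rcases lt_or_ge i n with h | h
  · obtain ⟨m, rfl⟩ := Nat.exists_eq_add_of_lt h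
    have e1 : i + m + 1 - i = m + 1 := by omega
    have e2 : i + m + 1 - (i + 1) = m := by omega
    have e3 : i + m + 1 + 1 - (i + 1) = m + 1 := by omega
    simp only [binomialWeight, e1, e2, e3, Nat.choose_succ_succ (i + m + 1) i]
    push_cast
    ring
  · rw [binomialWeight_eq_zero (Nat.lt_succ_of_le h)]
    rcases h.eq_or_lt with rfl | h
    · simp [binomialWeight, pow_succ, mul_comm]
    · rw [binomialWeight_eq_zero h, binomialWeight_eq_zero (Nat.succ_lt_succ h)]
      simp

lemma succ_mul_binomialWeight (lam : ℝ) (n k : ℕ) :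
    ((n : ℝ) + 1) * ((1 - lam) * binomialWeight lam n k)
      = (k + 1) * binomialWeight lam (n + 1) (k + 1) := by
  have h1 := sub_mul_binomialWeight lam n k
  have h2 := binomialWeight_succ_succ lam n k
  rw [h2]
  linear_combination h1

/-- An extra trial takes the count above k exactly when it stood at k and the new trial is counted.
-/
lemma binomialCdf_succ (lam : ℝ) (k n : ℕ) :
    binomialCdf lam k (n + 1) = binomialCdf lam k n - (1 - lam) * binomialWeight lam n k := by
  induction k with
  | zero =>
    simp [binomialCdf, binomialWeight_succ_zero]
    ring
  | succ k ih =>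
    have e (m : ℕ) : binomialCdf lam (k + 1) m
        = binomialCdf lam k m + binomialWeight lam m (k + 1) := Finset.sum_range_succ _ _
    rw [e, e, ih, binomialWeight_succ_succ]
    ring

lemma binomialCdf_antitone {lam : ℝ} (h0 : 0 < lam) (h1 : lam < 1) (k : ℕ) :
    Antitone (binomialCdf lam k) := by
  refine antitone_nat_of_succ_le fun n => ?_
  rw [binomialCdf_succ]
  have := mul_nonneg (sub_nonneg.2 h1.le) (binomialWeight_nonneg h0 h1 n k)
  linarith

/-- The ratio of consecutive coefficients, (j - m) / (m + 1), increases with j; the claim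
accumulates these ratios from i to m. -/
lemma choose_mul_choose_le {i m j j' : ℕ} (him : i ≤ m) (hjj : j ≤ j') :
    j'.choose i * j.choose m ≤ j.choose i * j'.choose m := by
  induction m, him using Nat.le_induction with
  | base => rw [mul_comm]
  | succ m _ ih =>
    refine Nat.le_of_mul_le_mul_right (c := m + 1) ?_ (Nat.succ_pos m)
    rw [mul_assoc, mul_assoc, Nat.choose_succ_right_eq, Nat.choose_succ_right_eq,
      ← mul_assoc, ← mul_assoc]
    exact Nat.mul_le_mul ih (Nat.sub_le_sub_right hjj m)

/-- The likelihood ratios of binomial weights are monotone in the number of trials. -/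
lemma binomialWeight_mul_le {lam : ℝ} (h0 : 0 < lam) (h1 : lam < 1) {i m j j' : ℕ} (him : i ≤ m)
    (hjj : j ≤ j') :
    binomialWeight lam j' i * binomialWeight lam j m
      ≤ binomialWeight lam j i * binomialWeight lam j' m := by
  rcases lt_or_ge j m with h | h
  · rw [binomialWeight_eq_zero h, mul_zero]
    exact mul_nonneg (binomialWeight_nonneg h0 h1 _ _) (binomialWeight_nonneg h0 h1 _ _)
  · have hc : ((j'.choose i * j.choose m : ℕ) : ℝ) ≤ (j.choose i * j'.choose m : ℕ) :=
      Nat.cast_le.2 (choose_mul_choose_le him hjj)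
    push_cast at hc
    have hp : lam ^ (j' - i) * lam ^ (j - m) = lam ^ (j - i) * lam ^ (j' - m) := by
      rw [← pow_add, ← pow_add]
      congr 1
      omega
    have hnu : 0 < 1 - lam := by linarith
    calc binomialWeight lam j' i * binomialWeight lam j m
        = (j'.choose i * j.choose m : ℝ)
          * ((1 - lam) ^ i * (1 - lam) ^ m * (lam ^ (j' - i) * lam ^ (j - m))) := by
          unfold binomialWeight; ring
      _ ≤ (j.choose i * j'.choose m : ℝ)
          * ((1 - lam) ^ i * (1 - lam) ^ m * (lam ^ (j' - i) * lam ^ (j - m))) := by gcongr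
      _ = _ := by rw [hp]; unfold binomialWeight; ring

lemma binomialCdf_mul_le {lam : ℝ} (h0 : 0 < lam) (h1 : lam < 1) {k j j' : ℕ} (hjj : j ≤ j') :
    binomialCdf lam k j' * binomialWeight lam j (k + 1)
      ≤ binomialCdf lam k j * binomialWeight lam j' (k + 1) := by
  unfold binomialCdf
  rw [Finset.sum_mul, Finset.sum_mul]
  refine Finset.sum_le_sum fun i hi => binomialWeight_mul_le h0 h1 ?_ hjj
  have := Finset.mem_range.1 hi
  omega

/-! ### Hazard rates and the Chernoff bound -/

/-- Summation by parts against the deviation from the mean. -/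
lemma sum_mean_sub_mul_binomialWeight (lam : ℝ) (n k : ℕ) :
    ∑ i ∈ Finset.range (k + 1), ((1 - lam) * n - i) * binomialWeight lam n i
      = ((n : ℝ) - k) * ((1 - lam) * binomialWeight lam n k) := by
  induction k with
  | zero => simp; ring
  | succ k ih =>
    rw [Finset.sum_range_succ, ih, sub_mul_binomialWeight]
    push_cast
    ring

/-- A second summation by parts: raising k by one adds the previous identity, which detailed balance
converts into the next term on the right. -/
lemma sum_mul_mean_sub_mul_binomialWeight (lam : ℝ) (n k : ℕ) :
    ∑ i ∈ Finset.range (k + 1), ((k : ℝ) - i) * (((1 - lam) * n - i) * binomialWeight lam n i)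
      = lam * ∑ i ∈ Finset.range (k + 1), (i : ℝ) * binomialWeight lam n i := by
  induction k with
  | zero => simp
  | succ k ih =>
    have e : ∑ i ∈ Finset.range (k + 1),
        (((k + 1 : ℕ) : ℝ) - i) * (((1 - lam) * n - i) * binomialWeight lam n i)
        = ∑ i ∈ Finset.range (k + 1), ((k : ℝ) - i) * (((1 - lam) * n - i) * binomialWeight lam n i)
          + ∑ i ∈ Finset.range (k + 1), ((1 - lam) * n - i) * binomialWeight lam n i := by
      rw [← Finset.sum_add_distrib]
      refine Finset.sum_congr rfl fun i _ => ?_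
      push_cast
      ring
    rw [Finset.sum_range_succ, e, ih, sum_mean_sub_mul_binomialWeight, sub_mul_binomialWeight,
      Finset.sum_range_succ _ (k + 1)]
    push_cast
    ring

/-- In the summation by parts, each deviation from the mean with i ≤ k is at least the one at k. -/
lemma hazard_lower {lam : ℝ} (h0 : 0 < lam) (h1 : lam < 1) (n k : ℕ) :
    ((1 - lam) * n - k) * binomialCdf lam k n
      ≤ ((n : ℝ) - k) * ((1 - lam) * binomialWeight lam n k) := by
  rw [← sum_mean_sub_mul_binomialWeight, binomialCdf, Finset.mul_sum]
  refine Finset.sum_le_sum fun i hi => ?_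
  have hik : (i : ℝ) ≤ k := by exact_mod_cast Nat.lt_succ_iff.1 (Finset.mem_range.1 hi)
  have := binomialWeight_nonneg h0 h1 n i
  gcongr

/-- The loss in `hazard_lower` is exactly A, the sum of (k - i) times the weights. The second
summation by parts bounds Δ A by lam k times the distribution function. -/
lemma hazard_upper {lam : ℝ} (h0 : 0 < lam) (h1 : lam < 1) (n k : ℕ)
    (hΔ : 0 < (1 - lam) * n - k) :
    ((n : ℝ) - k) * ((1 - lam) * binomialWeight lam n k)
      ≤ (((1 - lam) * n - k) + lam * k / ((1 - lam) * n - k)) * binomialCdf lam k n := by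
  set Δ := (1 - lam) * n - k with hΔdef
  have hle : ∀ i ∈ Finset.range (k + 1), (i : ℝ) ≤ k := fun i hi => by
    exact_mod_cast Nat.lt_succ_iff.1 (Finset.mem_range.1 hi)
  have hw := binomialWeight_nonneg h0 h1 n
  set A := ∑ i ∈ Finset.range (k + 1), ((k : ℝ) - i) * binomialWeight lam n i with hA
  have hfirst : ((n : ℝ) - k) * ((1 - lam) * binomialWeight lam n k)
      = Δ * binomialCdf lam k n + A := by
    rw [← sum_mean_sub_mul_binomialWeight, binomialCdf, Finset.mul_sum, hA,
      ← Finset.sum_add_distrib]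
    refine Finset.sum_congr rfl fun i _ => ?_
    rw [hΔdef]
    ring
  have hsecond : Δ * A ≤ lam * k * binomialCdf lam k n := by
    calc Δ * A ≤ ∑ i ∈ Finset.range (k + 1),
          ((k : ℝ) - i) * (((1 - lam) * n - i) * binomialWeight lam n i) := by
          rw [hA, Finset.mul_sum]
          refine Finset.sum_le_sum fun i hi => ?_
          have h2 := hle i hi
          have h3 : Δ ≤ (1 - lam) * n - i := by rw [hΔdef]; linarith
          have h4 := mul_nonneg (sub_nonneg.2 h2) (hw i)
          nlinarith [mul_le_mul_of_nonneg_right h3 h4]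
      _ = lam * ∑ i ∈ Finset.range (k + 1), (i : ℝ) * binomialWeight lam n i :=
          sum_mul_mean_sub_mul_binomialWeight lam n k
      _ ≤ lam * ∑ i ∈ Finset.range (k + 1), (k : ℝ) * binomialWeight lam n i := by
          refine mul_le_mul_of_nonneg_left (Finset.sum_le_sum fun i hi => ?_) h0.le
          exact mul_le_mul_of_nonneg_right (hle i hi) (hw i)
      _ = _ := by rw [← Finset.mul_sum, binomialCdf]; ring
  rw [hfirst, add_mul]
  have : A ≤ lam * k / Δ * binomialCdf lam k n := by
    rw [div_mul_eq_mul_div, le_div_iff₀ hΔ]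
    linarith
  linarith

/-- The Chernoff bound for the lower binomial tail. -/
lemma binomialCdf_mul_pow_le {lam y : ℝ} (h0 : 0 < lam) (h1 : lam < 1) (hy0 : 0 ≤ y) (hy1 : y ≤ 1)
    (k n : ℕ) : binomialCdf lam k n * y ^ k ≤ (lam + (1 - lam) * y) ^ n := by
  have hw := binomialWeight_nonneg h0 h1 n
  calc binomialCdf lam k n * y ^ k
      ≤ ∑ i ∈ Finset.range (k + 1), binomialWeight lam n i * y ^ i := by
        rw [binomialCdf, Finset.sum_mul]
        refine Finset.sum_le_sum fun i hi => mul_le_mul_of_nonneg_left ?_ (hw i)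
        exact pow_le_pow_of_le_one hy0 hy1 (Nat.lt_succ_iff.1 (Finset.mem_range.1 hi))
    -- This range contains both `range (k + 1)` and `range (n + 1)`, so k and n need not be
    -- compared.
    _ ≤ ∑ i ∈ Finset.range (n + 1 + (k + 1)), binomialWeight lam n i * y ^ i := by
        refine Finset.sum_le_sum_of_subset_of_nonneg
          (Finset.range_subset_range.2 (by omega)) fun i _ _ => ?_
        exact mul_nonneg (hw i) (pow_nonneg hy0 i)
    _ = ∑ i ∈ Finset.range (n + 1), binomialWeight lam n i * y ^ i := by
        rw [Finset.sum_range_add, add_eq_left]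
        refine Finset.sum_eq_zero fun i _ => ?_
        rw [binomialWeight_eq_zero (by omega), zero_mul]
    _ = (lam + (1 - lam) * y) ^ n := by
        rw [add_comm lam, add_pow]
        refine Finset.sum_congr rfl fun i _ => ?_
        rw [binomialWeight, mul_pow]
        ring

/-! ### Unimodality of the excess and the supporting line -/

/-- Up to the factor `N + 1`, the weight of an erroneous last system minus `η` times the acceptance
probability, for the state with exactly `j` erroneous systems out of `N + 1`. -/
def excess (lam : ℝ) (k N : ℕ) (η : ℝ) (j : ℕ) : ℝ :=
  (1 - η) * (j * binomialCdf lam k (j - 1)) - η * (((N : ℝ) + 1 - j) * binomialCdf lam k j)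

lemma excess_succ_sub (lam : ℝ) (k N : ℕ) (η : ℝ) (j : ℕ) :
    excess lam k N η (j + 1) - excess lam k N η j
      = binomialCdf lam k j + η * (((N : ℝ) - j) * ((1 - lam) * binomialWeight lam j k))
        - (1 - η) * ((k + 1) * binomialWeight lam j (k + 1)) := by
  have key : (j : ℝ) * binomialCdf lam k (j - 1)
      = j * binomialCdf lam k j + (k + 1) * binomialWeight lam j (k + 1) := by
    -- At `j = 0` the truncated `j - 1` is harmless because of the factor j.
    cases j with
    | zero => simp [binomialWeight_eq_zero]
    | succ n =>
      have := succ_mul_binomialWeight lam n k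
      rw [binomialCdf_succ, Nat.add_sub_cancel, ← this]
      push_cast
      ring
  unfold excess
  rw [key, Nat.add_sub_cancel, binomialCdf_succ]
  push_cast
  ring

/-- If the increment of `excess` vanishes at `z`, then `excess` is maximal at `z`. -/
lemma excess_le_of_stationary {lam : ℝ} (h0 : 0 < lam) (h1 : lam < 1) {k N z : ℕ} {η : ℝ}
    (hη : 0 ≤ η) (hkz : k < z) (hzN : z ≤ N)
    (hz : excess lam k N η (z + 1) = excess lam k N η z) {j : ℕ} (hj : j ≤ N + 1) :
    excess lam k N η j ≤ excess lam k N η z := by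
  have hν : 0 < 1 - lam := by linarith
  have hbz : 0 < binomialWeight lam z (k + 1) := binomialWeight_pos h0 h1 hkz
  have hstat := excess_succ_sub lam k N η z
  rw [hz, sub_self] at hstat
  -- With b i the weight at i for j trials, the increment over b (k + 1) is B / b (k + 1) + η (N -
  -- j) ν b k / b (k + 1) - (1 - η)(k + 1). Both quotients decrease in j, so the sign changes only
  -- once. Everything is cross-multiplied since b (k + 1) vanishes for j ≤ k.
  have hprod {i i' : ℕ} (hii : i ≤ i') (hiN : i' ≤ N) :
      (((N : ℝ) - i') * ((1 - lam) * binomialWeight lam i' k)) * binomialWeight lam i (k + 1)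
      ≤ (((N : ℝ) - i) * ((1 - lam) * binomialWeight lam i k)) * binomialWeight lam i' (k + 1) := by
    have e1 : (i : ℝ) ≤ i' := by exact_mod_cast hii
    have e2 : (i' : ℝ) ≤ N := by exact_mod_cast hiN
    have e3 := binomialWeight_mul_le h0 h1 (Nat.le_succ k) hii
    have e4 := mul_nonneg (binomialWeight_nonneg h0 h1 i' k) (binomialWeight_nonneg h0 h1 i (k + 1))
    calc _ = (((N : ℝ) - i') * (1 - lam))
          * (binomialWeight lam i' k * binomialWeight lam i (k + 1)) := by ring
      _ ≤ (((N : ℝ) - i) * (1 - lam))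
          * (binomialWeight lam i k * binomialWeight lam i' (k + 1)) := by
          refine mul_le_mul ?_ e3 e4 (mul_nonneg (by linarith) hν.le)
          gcongr
      _ = _ := by ring
  have hdown (i : ℕ) (hi : z ≤ i) (hiN : i ≤ N) :
      excess lam k N η (i + 1) ≤ excess lam k N η i := by
    rw [← sub_nonpos, excess_succ_sub]
    refine nonpos_of_mul_nonpos_left ?_ hbz
    have e1 := binomialCdf_mul_le h0 h1 (k := k) hi
    have e2 := mul_le_mul_of_nonneg_left (hprod hi hiN) hη
    have e3 := congrArg (· * binomialWeight lam i (k + 1)) hstat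
    simp only [zero_mul] at e3
    nlinarith
  have hup (i : ℕ) (hi : i ≤ z) (hzN : z ≤ N) :
      excess lam k N η i ≤ excess lam k N η (i + 1) := by
    rw [← sub_nonneg, excess_succ_sub]
    refine nonneg_of_mul_nonneg_left ?_ hbz
    have e1 := binomialCdf_mul_le h0 h1 (k := k) hi
    have e2 := mul_le_mul_of_nonneg_left (hprod hi hzN) hη
    have e3 := congrArg (· * binomialWeight lam i (k + 1)) hstat
    simp only [zero_mul] at e3
    nlinarith
  rcases le_total z j with h | h
  · induction j, h using Nat.le_induction with
    | base => exact le_rfl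
    | succ i hi ih => exact (hdown i hi (by omega)).trans (ih (by omega))
  · exact Nat.decreasingInduction (motive := fun i _ => excess lam k N η i ≤ excess lam k N η z)
      (fun i hi ih => (hup i hi.le hzN).trans ih) le_rfl h

/-- A supporting line of the region of achievable pairs of acceptance probability and error weight,
which passes below the point `(δ, ε δ)`. -/
lemma exists_supporting_line {lam : ℝ} (h0 : 0 < lam) (h1 : lam < 1) {k N n : ℕ} {ε δ : ℝ}
    (hkn : k ≤ n) (hnN : n + 1 ≤ N) (hδ : binomialCdf lam k n ≤ δ)
    (hε : (1 - ε) * ((n + 1) * binomialCdf lam k n) ≤ ε * ((N - n) * binomialCdf lam k (n + 1)))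
    (hη : binomialCdf lam k (n + 1) ≤ (k + 1) * binomialWeight lam (n + 1) (k + 1)) :
    ∃ η : ℝ, η ≤ ε ∧ ∀ j ≤ N + 1, excess lam k N η j ≤ (N + 1) * ((ε - η) * δ) := by
  have hN : (n : ℝ) + 1 ≤ N := by exact_mod_cast hnN
  set b := (k + 1) * binomialWeight lam (n + 1) (k + 1) with hb
  set B := binomialCdf lam k (n + 1) with hB
  set q := ((N : ℝ) - (n + 1)) * ((1 - lam) * binomialWeight lam (n + 1) k) with hq
  have hbpos : 0 < b := mul_pos (by positivity) (binomialWeight_pos h0 h1 (by omega))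
  have hBpos : 0 < B := binomialCdf_pos h0 h1 _ _
  have hqnn : 0 ≤ q := mul_nonneg (by linarith)
    (mul_nonneg (by linarith) (binomialWeight_nonneg h0 h1 _ _))
  -- The root of the increment from n + 1 to n + 2, which is affine in η.
  obtain ⟨η, hηdef⟩ : ∃ η, η = (b - B) / (q + b) := ⟨_, rfl⟩
  have hη' : η * (q + b) = b - B := by rw [hηdef]; field_simp
  have hη0 : 0 ≤ η := by rw [hηdef]; exact div_nonneg (by linarith) (by linarith)
  have hη1 : η < 1 := by rw [hηdef, div_lt_one (by linarith)]; linarith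
  have hstat : excess lam k N η (n + 1 + 1) = excess lam k N η (n + 1) := by
    rw [← sub_eq_zero, excess_succ_sub, ← hb, ← hB]
    push_cast
    rw [← hq]
    linarith
  have hmax {j : ℕ} (hj : j ≤ N + 1) :=
    excess_le_of_stationary h0 h1 hη0 (by omega) hnN hstat hj
  set h := (n + 1) * binomialCdf lam k n + ((N : ℝ) - n) * B with hh
  have hz : excess lam k N η (n + 1) ≤ (ε - η) * h := by
    unfold excess
    rw [← hB, Nat.add_sub_cancel]
    push_cast
    rw [hh]
    nlinarith
  have hCpos := binomialCdf_pos h0 h1 k n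
  have hhpos : 0 < h := by
    have : 0 < (n + 1) * binomialCdf lam k n := by positivity
    have : 0 ≤ ((N : ℝ) - n) * B := mul_nonneg (by linarith) hBpos.le
    linarith
  have hhle : h ≤ (N + 1) * δ := by
    have e1 : B ≤ binomialCdf lam k n := binomialCdf_antitone h0 h1 k (Nat.le_succ n)
    have e2 : ((N : ℝ) - n) * B ≤ (N - n) * binomialCdf lam k n :=
      mul_le_mul_of_nonneg_left e1 (by linarith)
    have e3 : ((N : ℝ) + 1) * binomialCdf lam k n ≤ (N + 1) * δ :=
      mul_le_mul_of_nonneg_left hδ (by positivity)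
    rw [hh]
    linarith
  have hηε : η ≤ ε := by
    -- With all systems erroneous the excess is nonnegative, hence so is its maximum, which is at
    -- most (ε - η) h.
    have e1 : 0 ≤ excess lam k N η (N + 1) := by
      unfold excess
      push_cast
      have := binomialCdf_pos h0 h1 k N
      rw [sub_self, zero_mul, mul_zero, sub_zero]
      exact mul_nonneg (by linarith) (by positivity)
    have e2 : 0 ≤ (ε - η) * h := e1.trans ((hmax le_rfl).trans hz)
    exact sub_nonneg.1 (nonneg_of_mul_nonneg_left e2 hhpos)
  refine ⟨η, hηε, fun j hj => (hmax hj).trans (hz.trans ?_)⟩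
  calc (ε - η) * h ≤ (ε - η) * ((N + 1) * δ) := mul_le_mul_of_nonneg_left hhle (by linarith)
    _ = _ := by ring

/-! ### Quantitative choice of the number of errors -/

/-- The right side is the optimised Chernoff exponent per unit of Q in `binomialCdf_le_exp`. The
difference vanishes at v = 0 and is increasing, by log x ≤ x - 1 at x = (1 - v) / (1 - ν v). -/
lemma klGap_lower {lam v : ℝ} (h0 : 0 < lam) (h1 : lam < 1) (hv0 : 0 ≤ v) (hv1 : v ≤ 1) :
    lam * (1 - lam) * v ^ 2 / 2 ≤ (1 - lam) * ((1 - v) * Real.log (1 - v))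
      - (1 - (1 - lam) * v) * Real.log (1 - (1 - lam) * v) := by
  have hν : 0 < 1 - lam := by linarith
  set g : ℝ → ℝ := fun v => (1 - lam) * ((1 - v) * Real.log (1 - v))
      - (1 - (1 - lam) * v) * Real.log (1 - (1 - lam) * v) - lam * (1 - lam) * v ^ 2 / 2 with hg
  have hcont : Continuous g := by
    have h1 : Continuous fun v : ℝ => (1 - v) * Real.log (1 - v) :=
      Real.continuous_mul_log.comp (by fun_prop)
    have h2 : Continuous fun v : ℝ => (1 - (1 - lam) * v) * Real.log (1 - (1 - lam) * v) :=
      Real.continuous_mul_log.comp (by fun_prop)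
    fun_prop
  have hmono : MonotoneOn g (Set.Icc 0 1) := by
    refine monotoneOn_of_hasDerivWithinAt_nonneg (convex_Icc 0 1) hcont.continuousOn
      (f' := fun v => (1 - lam) * (Real.log (1 - (1 - lam) * v) - Real.log (1 - v) - lam * v)) ?_ ?_
    · intro x hx
      rw [interior_Icc] at hx
      refine HasDerivAt.hasDerivWithinAt ?_
      have hx1 : 1 - x ≠ 0 := by have := hx.2; linarith
      have hx2 : 1 - (1 - lam) * x ≠ 0 := by have := hx.1; have := hx.2; nlinarith
      have d1 : HasDerivAt (fun v : ℝ => 1 - v) (-1) x := by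
        simpa using (hasDerivAt_id x).const_sub 1
      have d2 : HasDerivAt (fun v : ℝ => 1 - (1 - lam) * v) (-(1 - lam)) x := by
        simpa using ((hasDerivAt_id x).const_mul (1 - lam)).const_sub 1
      have d3 := ((Real.hasDerivAt_mul_log hx1).comp x d1).const_mul (1 - lam)
      have d4 := (Real.hasDerivAt_mul_log hx2).comp x d2
      have d5 : HasDerivAt (fun v : ℝ => lam * (1 - lam) * v ^ 2 / 2) (lam * (1 - lam) * x) x := by
        have := (((hasDerivAt_id x).pow 2).const_mul (lam * (1 - lam))).div_const 2
        refine this.congr_deriv ?_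
        simp
        ring
      refine ((d3.sub d4).sub d5).congr_deriv ?_
      ring
    · intro x hx
      rw [interior_Icc] at hx
      obtain ⟨hx0, hx1⟩ := hx
      have p1 : 0 < 1 - x := by linarith
      have p2 : 0 < 1 - (1 - lam) * x := by nlinarith
      refine mul_nonneg hν.le ?_
      have := Real.log_le_sub_one_of_pos (div_pos p1 p2)
      rw [Real.log_div p1.ne' p2.ne'] at this
      have e : (1 - x) / (1 - (1 - lam) * x) ≤ 1 - lam * x := by
        rw [div_le_iff₀ p2]
        have : 0 ≤ lam * (1 - lam) * x ^ 2 := by positivity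
        nlinarith
      linarith
  have := hmono (Set.left_mem_Icc.2 zero_le_one) ⟨hv0, hv1⟩ hv0
  simp only [hg] at this
  norm_num at this
  linarith

/-- The lower tail of a binomial variable with `n = (1 - lam) S + lam Q` trials, at the fraction
`S / Q` of its mean. -/
lemma binomialCdf_le_exp {lam S Q : ℝ} (h0 : 0 < lam) (h1 : lam < 1) (hS : 0 ≤ S) (hSQ : S ≤ Q)
    (hQ : 0 < Q) {k n : ℕ} (hk : (k : ℝ) = (1 - lam) * S) (hn : (n : ℝ) = (1 - lam) * S + lam * Q) :
    binomialCdf lam k n ≤ Real.exp (-(lam * (1 - lam) * (Q - S) ^ 2 / (2 * Q))) := by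
  have hν : 0 < 1 - lam := by linarith
  set v := (Q - S) / Q with hv
  have hv0 : 0 ≤ v := div_nonneg (by linarith) hQ.le
  have hv1 : v ≤ 1 := by rw [hv, div_le_one hQ]; linarith
  have hSv : S = Q * (1 - v) := by rw [hv]; field_simp; ring
  have hnv : (n : ℝ) = Q * (1 - (1 - lam) * v) := by rw [hn, hSv]; ring
  have hkv : (k : ℝ) = Q * ((1 - lam) * (1 - v)) := by rw [hk, hSv]; ring
  have hqpos : 0 < 1 - (1 - lam) * v := by nlinarith
  -- The tilt 1 - v is optimal: it makes the tilted mean equal to k.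
  have hch := binomialCdf_mul_pow_le h0 h1 (sub_nonneg.2 hv1) (by linarith : 1 - v ≤ 1) k n
  have e : lam + (1 - lam) * (1 - v) = 1 - (1 - lam) * v := by ring
  rw [e] at hch
  -- At v = 1 the base vanishes, but then k = 0 as well.
  have hypos : 0 < (1 - v) ^ k := by
    rcases (sub_nonneg.2 hv1).eq_or_lt with h | h
    · have : k = 0 := by
        have : (k : ℝ) = 0 := by rw [hkv, ← h]; simp
        exact_mod_cast this
      simp [this]
    · positivity
  have hB := binomialCdf_pos h0 h1 k n
  rw [← Real.log_le_iff_le_exp hB]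
  have hlog := Real.log_le_log (mul_pos hB hypos) hch
  rw [Real.log_mul hB.ne' hypos.ne', Real.log_pow, Real.log_pow, hnv, hkv] at hlog
  have hgap := mul_le_mul_of_nonneg_left (klGap_lower h0 h1 hv0 hv1) hQ.le
  have e2 : lam * (1 - lam) * (Q - S) ^ 2 / (2 * Q) = Q * (lam * (1 - lam) * v ^ 2 / 2) := by
    rw [hv]; field_simp
  rw [e2]
  linarith

/-- Below the critical number of erroneous systems there is a number at which the acceptance
probability is at most `δ` while the infidelity is at most `ε`. -/
lemma exists_threshold {lam : ℝ} (h0 : 0 < lam) (h1 : lam < 1) {k N : ℕ} {ε δ D : ℝ}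
    (hε0 : 0 < ε) (hε1 : ε < 1) (hδ0 : 0 < δ) (hδ : δ ≤ 1 / 2) (hD : 0 < D)
    (hk : (k : ℝ) = (1 - lam) * (ε * N - D))
    (hN : ε * N * (Real.log δ⁻¹ + 4 * lam * (1 - lam) ^ 2) ≤ (lam * (1 - lam) * D) ^ 2) :
    ∃ n : ℕ, k ≤ n ∧ n + 1 ≤ N ∧ binomialCdf lam k n ≤ δ ∧
      (1 - ε) * ((n + 1) * binomialCdf lam k n) ≤ ε * ((N - n) * binomialCdf lam k (n + 1)) ∧
      binomialCdf lam k (n + 1) ≤ (k + 1) * binomialWeight lam (n + 1) (k + 1) := by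
  have hν : 0 < 1 - lam := by linarith
  set ν := 1 - lam with hνdef
  set L := Real.log δ⁻¹ with hL
  have hL2 : 0.69 ≤ L := by
    have : Real.log 2 ≤ L := Real.log_le_log two_pos
      (by rw [le_inv_comm₀ two_pos hδ0]; linarith)
    have := Real.log_two_gt_d9
    linarith
  set y := ε * N with hy
  obtain ⟨S, hS⟩ : ∃ S, S = y - D := ⟨_, rfl⟩
  rw [← hS] at hk
  have hS0 : 0 ≤ S := by
    have : 0 ≤ ν * S := by rw [← hk]; positivity
    exact nonneg_of_mul_nonneg_right this hν
  have hyD : y = S + D := by linarith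
  have hypos : 0 < y := by linarith
  obtain ⟨a, ha⟩ : ∃ a, a = lam * ν ^ 2 := ⟨_, rfl⟩
  have ha0 : 0 < a := by rw [ha]; positivity
  have ha1 : a ≤ 4 / 27 := by
    have : 0 ≤ (lam - 1 / 3) ^ 2 * (4 / 3 - lam) := mul_nonneg (sq_nonneg _) (by linarith)
    rw [ha, hνdef]
    linarith
  have hT : 0 < L + 4 * a := by linarith
  -- The share of slack in the hypothesis on N: 1 - 4 w = L / (L + 4 a).
  obtain ⟨w, hw⟩ : ∃ w, w = a / (L + 4 * a) := ⟨_, rfl⟩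
  have hwT : w * (L + 4 * a) = a := by rw [hw]; field_simp
  have hw0 : 0 < w := by rw [hw]; positivity
  have hw1 : w ≤ 0.12 := by
    rw [hw, div_le_iff₀ hT]
    linarith
  have hN' : y * (L + 4 * a) ≤ (lam * ν * D) ^ 2 := by rw [ha]; linarith
  have hyw : y ≤ lam * w * D ^ 2 := by
    refine le_of_mul_le_mul_right (hN'.trans (le_of_eq ?_)) hT
    have e : lam * w * D ^ 2 * (L + 4 * a) = lam * D ^ 2 * (w * (L + 4 * a)) := by ring
    rw [e, hwT, ha]
    ring
  have hwD : 1 ≤ lam * w * D := by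
    refine le_of_mul_le_mul_right ?_ hD
    nlinarith
  -- Chernoff will need 2 σ² ≥ 1 - 4 w, so t lies just above (1 - 2 w) / √2. Rounding n up raises σ
  -- by at most 1 / (lam D) ≤ w, which keeps σ ≤ 0.71.
  obtain ⟨t, ht⟩ : ∃ t, t = 0.71 * (1 - 2 * w) := ⟨_, rfl⟩
  have ht0 : 0.53 ≤ t := by rw [ht]; linarith
  set n := ⌈S + t * lam * D⌉₊ with hn
  have hn0 : S + t * lam * D ≤ n := Nat.le_ceil _
  have hn1 : (n : ℝ) < S + t * lam * D + 1 := Nat.ceil_lt_add_one (by positivity)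
  obtain ⟨σ, hσ⟩ : ∃ σ, σ = (n - S) / (lam * D) := ⟨_, rfl⟩
  have hnσ : (n : ℝ) = S + lam * σ * D := by rw [hσ]; field_simp; ring
  have hσt : t ≤ σ := by
    rw [hσ, le_div_iff₀ (by positivity)]
    linarith
  have hσu : σ ≤ 0.71 := by
    have : σ ≤ t + w := by
      rw [hσ, div_le_iff₀ (by positivity)]
      linarith
    linarith
  have hσ0 : 0.53 ≤ σ := ht0.trans hσt
  have hσpos : 0 < σ := by linarith
  have hσσ : w ≤ σ * (1 - σ) := by
    have : σ * 0.29 ≤ σ * (1 - σ) := by gcongr; linarith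
    linarith
  have hlν : lam * ν ≤ 1 / 4 := by
    have := sq_nonneg (lam - 1 / 2)
    rw [hνdef]
    linarith
  have hlν0 : 0 < lam * ν := by positivity
  have hΔ : ν * n - k = lam * ν * σ * D := by rw [hnσ, hk]; ring
  have hΔ1 : 1 ≤ ν * n - k := by
    rw [hΔ]
    have e1 : D * 0.69 ≤ D * (lam * ν * (lam * ν * D)) := by
      have : D * 0.69 ≤ y * (L + 4 * a) := by gcongr <;> linarith
      linarith
    have e2 : 0.69 ≤ lam * ν * (lam * ν * D) := le_of_mul_le_mul_left e1 hD
    have e3 : 0 < lam * ν * D := by positivity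
    have e4 : lam * ν * (lam * ν * D) ≤ 1 / 4 * (lam * ν * D) := by gcongr
    have e5 : 0.53 * (lam * ν * D) ≤ σ * (lam * ν * D) := by gcongr
    linarith
  have hΔpos : 0 < ν * n - k := by linarith
  have hnk : (n : ℝ) - k = lam * (S + σ * D) := by rw [hnσ, hk, hνdef]; ring
  have hnkpos : 0 < (n : ℝ) - k := by rw [hnk]; positivity
  have hkn : k ≤ n := by
    have : (k : ℝ) ≤ n := by linarith
    exact_mod_cast this
  -- The infidelity condition after inserting `hazard_upper`. In terms of S, D and σ, the terms
  -- containing S cancel in `e8`, which reduces to w ≤ σ (1 - σ); the -1 is paid by `e4`.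
  have hmain : y * ((ν * n - k) + lam * k / (ν * n - k)) ≤ (y - n - 1) * ((n : ℝ) - k) := by
    have e1 : lam * k / (ν * n - k) = S / (σ * D) := by
      rw [hΔ, hk]
      field_simp
    have e2 : y * (S / (σ * D)) ≤ lam * (w * D * S / σ) := by
      have : y * (S / (σ * D)) ≤ (lam * w * D ^ 2) * (S / (σ * D)) := by gcongr
      refine this.trans (le_of_eq ?_)
      field_simp
    have e3 : w / σ ≤ 1 - σ := by rw [div_le_iff₀ hσpos]; linarith
    have e4 : S + σ * D ≤ lam * w * D ^ 2 := by
      have : σ * D ≤ 1 * D := by gcongr; linarith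
      linarith
    have e5 : w * D * S / σ ≤ D * S * (1 - σ) := by
      have : D * S * (w / σ) ≤ D * S * (1 - σ) := by gcongr
      refine le_trans (le_of_eq ?_) this
      ring
    have e6 : lam * D ^ 2 * w ≤ lam * D ^ 2 * (σ * (1 - σ)) := by gcongr
    rw [e1, mul_add, hnk, hΔ]
    have e7 : y - n - 1 = (1 - lam * σ) * D - 1 := by rw [hnσ, hyD]; ring
    rw [e7]
    have e8 : y * (lam * ν * σ * D) + lam * (D * S * (1 - σ))
        ≤ ((1 - lam * σ) * D) * (lam * (S + σ * D)) - lam * (lam * w * D ^ 2) := by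
      have : lam * (lam * D ^ 2 * w) ≤ lam * (lam * D ^ 2 * (σ * (1 - σ))) := by gcongr
      rw [hyD, hνdef]
      linarith
    have e9 : lam * (S + σ * D) ≤ lam * (lam * w * D ^ 2) := by gcongr
    have e10 : lam * (w * D * S / σ) ≤ lam * (D * S * (1 - σ)) := by gcongr
    linarith
  have hy1 : 0 ≤ y - n - 1 := by
    refine nonneg_of_mul_nonneg_left (le_trans ?_ hmain) hnkpos
    positivity
  have hnN : n + 1 ≤ N := by
    have : (n : ℝ) + 1 ≤ N := by
      have : y ≤ N := by rw [hy]; exact mul_le_of_le_one_left (Nat.cast_nonneg N) hε1.le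
      linarith
    exact_mod_cast this
  have hB := binomialCdf_pos h0 h1 k n
  have hb := binomialWeight_nonneg h0 h1 n k
  refine ⟨n, hkn, hnN, ?_, ?_, ?_⟩
  · have hQ : 0 < S + σ * D := by positivity
    have hexp := binomialCdf_le_exp h0 h1 hS0 (Q := S + σ * D)
      (le_add_of_nonneg_right (by positivity)) hQ hk (by rw [hnσ]; ring)
    refine hexp.trans ?_
    rw [← Real.le_log_iff_exp_le hδ0, neg_le, ← Real.log_inv, ← hL, le_div_iff₀ (by positivity)]
    have e1 : S + σ * D ≤ y := by
      have : σ * D ≤ 1 * D := by gcongr; linarith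
      linarith
    have e2 : L * (2 * (S + σ * D)) ≤ 2 * (y * L) := by
      have : L * (S + σ * D) ≤ L * y := by gcongr
      linarith
    have e3 : (1 - 4 * w) * (L + 4 * a) = L := by linarith
    have e4 : 1 - 4 * w ≤ 2 * σ ^ 2 := by
      have : t ^ 2 ≤ σ ^ 2 := by gcongr
      have : 1 - 4 * w ≤ 2 * t ^ 2 := by rw [ht]; have := sq_nonneg w; linarith
      linarith
    have e5 : L ≤ 2 * σ ^ 2 * (L + 4 * a) := by
      calc L = (1 - 4 * w) * (L + 4 * a) := e3.symm
        _ ≤ _ := by gcongr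
    have e6 : y * L ≤ 2 * σ ^ 2 * (lam * ν * D) ^ 2 := by
      calc y * L ≤ y * (2 * σ ^ 2 * (L + 4 * a)) := by gcongr
        _ = 2 * σ ^ 2 * (y * (L + 4 * a)) := by ring
        _ ≤ _ := by gcongr
    -- Uses 4 lam ν ≤ 1.
    have e7 : 4 * σ ^ 2 * (lam * ν * D) ^ 2 ≤ lam * ν * (S + σ * D - S) ^ 2 := by
      have : 0 ≤ lam * ν * (σ * D) ^ 2 := by positivity
      have : lam * ν * (lam * ν * (σ * D) ^ 2) ≤ 1 / 4 * (lam * ν * (σ * D) ^ 2) := by gcongr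
      linarith
    linarith
  · have hup := hazard_upper h0 h1 n k hΔpos
    rw [binomialCdf_succ]
    have e1 : y * ((1 - lam) * binomialWeight lam n k) ≤ (y - n - 1) * binomialCdf lam k n := by
      refine le_of_mul_le_mul_right ?_ hnkpos
      calc y * ((1 - lam) * binomialWeight lam n k) * ((n : ℝ) - k)
          = y * (((n : ℝ) - k) * ((1 - lam) * binomialWeight lam n k)) := by ring
        _ ≤ y * ((ν * n - k + lam * k / (ν * n - k)) * binomialCdf lam k n) := by gcongr
        _ = y * (ν * n - k + lam * k / (ν * n - k)) * binomialCdf lam k n := by ring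
        _ ≤ (y - n - 1) * ((n : ℝ) - k) * binomialCdf lam k n := by gcongr
        _ = _ := by ring
    have e2 : 0 ≤ ε * n * ((1 - lam) * binomialWeight lam n k) := by positivity
    have e3 : 0 ≤ ε * binomialCdf lam k n := by positivity
    rw [hy] at e1
    linarith
  · rw [← succ_mul_binomialWeight]
    have hlow := hazard_lower h0 h1 n k
    have e1 : binomialCdf lam k n ≤ (ν * n - k) * binomialCdf lam k n :=
      le_mul_of_one_le_left hB.le hΔ1
    have e2 : binomialCdf lam k (n + 1) ≤ binomialCdf lam k n :=
      binomialCdf_antitone h0 h1 k (Nat.le_succ n)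
    have e3 : ((n : ℝ) - k) * ((1 - lam) * binomialWeight lam n k)
        ≤ ((n : ℝ) + 1) * ((1 - lam) * binomialWeight lam n k) := by
      have : (0 : ℝ) ≤ k := Nat.cast_nonneg k
      gcongr
      linarith
    linarith

/-! ### Tensor products and error patterns -/

section Tensor

variable {ι : Type*}

lemma tensorOp_mul [Fintype ι] {m : ℕ} (A B : Fin m → Matrix ι ι ℂ) :
    tensorOp A * tensorOp B = tensorOp fun j => A j * B j := by
  ext x y
  simp only [tensorOp, Matrix.mul_apply, Matrix.of_apply, Finset.prod_univ_sum,
    Fintype.piFinset_univ, Finset.prod_mul_distrib]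

lemma tensorOp_one [DecidableEq ι] (m : ℕ) : tensorOp (fun _ : Fin m => (1 : Matrix ι ι ℂ)) = 1 := by
  ext x y
  by_cases h : x = y
  · subst h
    simp [tensorOp]
  · obtain ⟨j, hj⟩ := Function.ne_iff.1 h
    rw [Matrix.one_apply_ne h]
    exact Finset.prod_eq_zero (Finset.mem_univ j) (Matrix.one_apply_ne hj)

lemma conjTranspose_tensorOp {m : ℕ} (A : Fin m → Matrix ι ι ℂ) :
    (tensorOp A).conjTranspose = tensorOp fun j => (A j).conjTranspose := by
  ext x y
  simp [tensorOp]

lemma trace_tensorOp [Fintype ι] {m : ℕ} (A : Fin m → Matrix ι ι ℂ) :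
    (tensorOp A).trace = ∏ j, (A j).trace := by
  simp only [tensorOp, Matrix.trace, Matrix.diag_apply, Matrix.of_apply, Finset.prod_univ_sum,
    Fintype.piFinset_univ]

lemma sum_mul_star_eq_one [Fintype ι] {Ψ : EuclideanSpace ℂ ι} (hΨ : ‖Ψ‖ = 1) :
    ∑ a, Ψ a * star (Ψ a) = 1 := by
  have h := EuclideanSpace.norm_sq_eq Ψ
  rw [hΨ] at h
  have e (a : ι) : Ψ a * star (Ψ a) = ((‖Ψ a‖ ^ 2 : ℝ) : ℂ) := by
    rw [Complex.star_def, Complex.mul_conj, Complex.normSq_eq_norm_sq]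
  rw [Finset.sum_congr rfl fun a _ => e a, ← Complex.ofReal_sum, ← h]
  norm_num

lemma trace_proj [Fintype ι] {Ψ : EuclideanSpace ℂ ι} (hΨ : ‖Ψ‖ = 1) : (proj Ψ).trace = 1 :=
  sum_mul_star_eq_one hΨ

lemma proj_mul_proj [Fintype ι] {Ψ : EuclideanSpace ℂ ι} (hΨ : ‖Ψ‖ = 1) :
    proj Ψ * proj Ψ = proj Ψ := by
  ext a b
  simp only [proj, Matrix.mul_apply, Matrix.of_apply]
  calc ∑ c, Ψ a * star (Ψ c) * (Ψ c * star (Ψ b))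
      = Ψ a * star (Ψ b) * ∑ c, Ψ c * star (Ψ c) := by
        rw [Finset.mul_sum]
        exact Finset.sum_congr rfl fun c _ => by ring
    _ = _ := by rw [sum_mul_star_eq_one hΨ, mul_one]

lemma conjTranspose_proj (Ψ : EuclideanSpace ℂ ι) : (proj Ψ).conjTranspose = proj Ψ := by
  ext a b
  simp [proj, mul_comm]

/-- The projector onto the states that are erroneous exactly on the systems in `S`. -/
def patternOp [DecidableEq ι] {m : ℕ} (Ψ : EuclideanSpace ℂ ι) (S : Finset (Fin m)) :
    Matrix (Fin m → ι) (Fin m → ι) ℂ :=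
  tensorOp fun j => if j ∈ S then 1 - proj Ψ else proj Ψ

lemma patternOp_mul_self [Fintype ι] [DecidableEq ι] {m : ℕ} {Ψ : EuclideanSpace ℂ ι} (hΨ : ‖Ψ‖ = 1)
    (S : Finset (Fin m)) :
    patternOp Ψ S * patternOp Ψ S = patternOp Ψ S := by
  rw [patternOp, tensorOp_mul]
  congr 1
  funext j
  split_ifs
  · simp [sub_mul, mul_sub, proj_mul_proj hΨ]
  · exact proj_mul_proj hΨ

lemma conjTranspose_patternOp [DecidableEq ι] {m : ℕ} (Ψ : EuclideanSpace ℂ ι)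
    (S : Finset (Fin m)) :
    (patternOp Ψ S).conjTranspose = patternOp Ψ S := by
  rw [patternOp, conjTranspose_tensorOp]
  congr 1
  funext j
  split_ifs <;> simp [conjTranspose_proj]

lemma posSemidef_patternOp [Fintype ι] [DecidableEq ι] {m : ℕ} {Ψ : EuclideanSpace ℂ ι} (hΨ : ‖Ψ‖ = 1)
    (S : Finset (Fin m)) :
    (patternOp Ψ S).PosSemidef := by
  have := Matrix.posSemidef_conjTranspose_mul_self (patternOp Ψ S)
  rwa [conjTranspose_patternOp, patternOp_mul_self hΨ] at this

/-- The probability that the erroneous systems are exactly those in `S`. -/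
def patternProb [Fintype ι] [DecidableEq ι] {m : ℕ} (Ψ : EuclideanSpace ℂ ι)
    (ρ : Matrix (Fin m → ι) (Fin m → ι) ℂ)
    (S : Finset (Fin m)) : ℝ :=
  ((patternOp Ψ S * ρ).trace).re

lemma patternProb_nonneg [Fintype ι] [DecidableEq ι] {m : ℕ} {Ψ : EuclideanSpace ℂ ι} (hΨ : ‖Ψ‖ = 1)
    {ρ : Matrix (Fin m → ι) (Fin m → ι) ℂ} (hρ : ρ.PosSemidef) (S : Finset (Fin m)) :
    0 ≤ patternProb Ψ ρ S := by
  have h := (hρ.mul_mul_conjTranspose_same (patternOp Ψ S)).trace_nonneg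
  rw [conjTranspose_patternOp, Matrix.trace_mul_comm, ← Matrix.mul_assoc,
    patternOp_mul_self hΨ] at h
  exact (Complex.le_def.1 h).1

/-- A permutation of the systems carrying S to T conjugates one pattern projector into the other and
fixes ρ. -/
lemma patternProb_eq_of_card_eq [Fintype ι] [DecidableEq ι] {m : ℕ} (Ψ : EuclideanSpace ℂ ι)
    {ρ : Matrix (Fin m → ι) (Fin m → ι) ℂ} (hρ : IsPermInvariant ρ) {S T : Finset (Fin m)}
    (h : S.card = T.card) : patternProb Ψ ρ S = patternProb Ψ ρ T := by
  obtain ⟨σ, hσ⟩ : ∃ σ : Equiv.Perm (Fin m), ∀ j, j ∈ S ↔ σ j ∈ T := by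
    let e : {x // x ∈ S} ≃ {x // x ∈ T} := S.equivOfCardEq h
    refine ⟨e.extendSubtype, fun j => ⟨fun hj => e.extendSubtype_mem j hj, fun hj => ?_⟩⟩
    by_contra hn
    exact e.extendSubtype_not_mem j hn hj
  unfold patternProb
  congr 1
  simp only [Matrix.trace, Matrix.diag_apply, Matrix.mul_apply]
  let τ : (Fin m → ι) ≃ (Fin m → ι) := Equiv.arrowCongr σ.symm (Equiv.refl ι)
  have hτ (x : Fin m → ι) : τ x = x ∘ σ := rfl
  rw [← Equiv.sum_comp τ]
  refine Finset.sum_congr rfl fun x _ => ?_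
  rw [← Equiv.sum_comp τ]
  refine Finset.sum_congr rfl fun y _ => ?_
  rw [hτ, hτ, hρ σ]
  congr 1
  simp only [patternOp, tensorOp, Matrix.of_apply, Function.comp_apply]
  refine Eq.trans ?_ (Equiv.prod_comp σ _)
  exact Finset.prod_congr rfl fun j _ => by simp only [hσ j]

/-- Expansion of a tensor product of operators that are diagonal with respect to the target state
and its complement. -/
lemma tensorOp_eq_sum_patternOp [DecidableEq ι] {m : ℕ} (Ψ : EuclideanSpace ℂ ι) (α β : Fin m → ℝ) :
    tensorOp (fun j => (α j : ℂ) • proj Ψ + (β j : ℂ) • (1 - proj Ψ))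
      = ∑ S : Finset (Fin m), (((∏ j ∈ S, β j) * ∏ j ∈ Finset.univ \ S, α j : ℝ) : ℂ)
          • patternOp Ψ S := by
  ext x y
  rw [Matrix.sum_apply]
  simp only [tensorOp, patternOp, Matrix.of_apply, Matrix.smul_apply, Matrix.add_apply,
    smul_eq_mul]
  rw [Finset.prod_congr rfl fun j _ => add_comm _ _, Finset.prod_add, Finset.powerset_univ]
  refine Finset.sum_congr rfl fun S _ => ?_
  have e : ∏ j, (if j ∈ S then 1 - proj Ψ else proj Ψ) (x j) (y j)
      = (∏ j ∈ S, (1 - proj Ψ) (x j) (y j)) * ∏ j ∈ Finset.univ \ S, proj Ψ (x j) (y j) := by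
    have := Finset.prod_piecewise Finset.univ S (fun j => (1 - proj Ψ) (x j) (y j))
      (fun j => proj Ψ (x j) (y j))
    rw [Finset.univ_inter] at this
    rw [← this]
    refine Finset.prod_congr rfl fun j _ => ?_
    simp only [Finset.piecewise]
    split_ifs <;> rfl
  rw [e, Finset.prod_mul_distrib, Finset.prod_mul_distrib]
  push_cast
  ring

lemma trace_tensorOp_mul_re [Fintype ι] [DecidableEq ι] {m : ℕ} (Ψ : EuclideanSpace ℂ ι)
    (α β : Fin m → ℝ)
    (ρ : Matrix (Fin m → ι) (Fin m → ι) ℂ) :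
    ((tensorOp (fun j => (α j : ℂ) • proj Ψ + (β j : ℂ) • (1 - proj Ψ)) * ρ).trace).re
      = ∑ S : Finset (Fin m), ((∏ j ∈ S, β j) * ∏ j ∈ Finset.univ \ S, α j)
          * patternProb Ψ ρ S := by
  rw [tensorOp_eq_sum_patternOp, Finset.sum_mul, Matrix.trace_sum, Complex.re_sum]
  refine Finset.sum_congr rfl fun S _ => ?_
  rw [Matrix.smul_mul, Matrix.trace_smul, smul_eq_mul, Complex.re_ofReal_mul]
  rfl

end Tensor

/-! ### Acceptance statistics via generating polynomials -/

section Statistics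

open Polynomial

/-- X marks an erroneous system: a passed test contributes lam X + 1, a failed one (1 - lam) X.
Choosing the failures and then the other errors equals choosing all errors and then the failures
among them. -/
lemma choose_mul_passPoly (lam : ℝ) {N i : ℕ} (hi : i ≤ N) :
    C (N.choose i : ℝ) * ((C lam * X + C 1) ^ (N - i) * (C (1 - lam) * X + C 0) ^ i)
      = ∑ j ∈ Finset.range (N + 1), C ((N.choose j : ℝ) * binomialWeight lam j i) * X ^ j := by
  obtain ⟨l, rfl⟩ := Nat.exists_eq_add_of_le hi
  rw [add_assoc i l 1, Finset.sum_range_add, Finset.sum_eq_zero (s := Finset.range i), zero_add,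
    Nat.add_sub_cancel_left, add_pow, Finset.sum_mul, Finset.mul_sum]
  · refine Finset.sum_congr rfl fun r hr => ?_
    have hr' : r ≤ l := Nat.lt_succ_iff.1 (Finset.mem_range.1 hr)
    have hc : ((i + l).choose (i + r) : ℝ) * (i + r).choose i = (i + l).choose i * l.choose r := by
      have := Nat.choose_mul (n := i + l) (k := i + r) (s := i) (by omega)
      rw [Nat.add_sub_cancel_left, Nat.add_sub_cancel_left] at this
      exact_mod_cast this
    have e : ((i + l).choose (i + r) : ℝ) * binomialWeight lam (i + r) i
        = (i + l).choose i * l.choose r * ((1 - lam) ^ i * lam ^ r) := by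
      rw [binomialWeight, Nat.add_sub_cancel_left, ← hc]
      ring
    rw [e]
    simp only [C_mul, C_pow, C_1, C_0, add_zero, one_pow, map_natCast]
    ring
  · intro j hj
    rw [binomialWeight_eq_zero (Finset.mem_range.1 hj), mul_zero, C_0, zero_mul]

variable {ι : Type*} [Fintype ι] [DecidableEq ι]

/-- The linear functional on polynomials that sends `X ^ j` to `m j`. -/
def momentFunctional (m : ℕ → ℝ) : ℝ[X] →ₗ[ℝ] ℝ :=
  lsum fun j => m j • LinearMap.id

lemma momentFunctional_C_mul_X_pow (m : ℕ → ℝ) (c : ℝ) (j : ℕ) :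
    momentFunctional m (C c * X ^ j) = c * m j := by
  rw [C_mul_X_pow_eq_monomial, momentFunctional, lsum_apply, sum_monomial_index _ _ (by simp)]
  simp [mul_comm]

/-- Pattern probabilities depend only on cardinality, so expanding the tensor product matches
expanding a product of linear polynomials, with X ^ j replaced by `m j`. -/
lemma trace_tensorOp_mul_re_eq_momentFunctional {n : ℕ} (Ψ : EuclideanSpace ℂ ι) (α β : Fin n → ℝ)
    (ρ : Matrix (Fin n → ι) (Fin n → ι) ℂ) {m : ℕ → ℝ}
    (hm : ∀ S : Finset (Fin n), patternProb Ψ ρ S = m S.card) :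
    ((tensorOp (fun j => (α j : ℂ) • proj Ψ + (β j : ℂ) • (1 - proj Ψ)) * ρ).trace).re
      = momentFunctional m (∏ j, (C (β j) * X + C (α j))) := by
  rw [trace_tensorOp_mul_re, Finset.prod_add, Finset.powerset_univ, map_sum]
  refine Finset.sum_congr rfl fun S _ => ?_
  rw [hm, Finset.prod_mul_distrib, Finset.prod_const, ← map_prod, ← map_prod,
    mul_right_comm (C _), ← C_mul, momentFunctional_C_mul_X_pow]

lemma trace_testOp_mul_re (Ψ : EuclideanSpace ℂ ι) (lam : ℝ) {N i : ℕ} (hi : i ≤ N)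
    (ρ : Matrix (Fin (N + 1) → ι) (Fin (N + 1) → ι) ℂ) {m : ℕ → ℝ}
    (hm : ∀ S : Finset (Fin (N + 1)), patternProb Ψ ρ S = m S.card)
    {E : Matrix ι ι ℂ} {b : ℝ} (hE : E = proj Ψ + (b : ℂ) • (1 - proj Ψ)) :
    ((testOp Ψ lam N i E * ρ).trace).re
      = momentFunctional m (((C lam * X + C 1) ^ (N - i) * (C (1 - lam) * X + C 0) ^ i)
          * (C b * X + C 1)) := by
  let α : Fin (N + 1) → ℝ := fun j => if (j : ℕ) < N - i then 1 else if (j : ℕ) < N then 0 else 1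
  let β : Fin (N + 1) → ℝ := fun j =>
    if (j : ℕ) < N - i then lam else if (j : ℕ) < N then 1 - lam else b
  have e : testOp Ψ lam N i E
      = tensorOp fun j => (α j : ℂ) • proj Ψ + (β j : ℂ) • (1 - proj Ψ) := by
    unfold testOp
    congr 1
    funext j
    simp only [α, β]
    split_ifs
    · simp [verificationOp]
    · simp only [verificationOp, Complex.ofReal_sub, Complex.ofReal_one, Complex.ofReal_zero]
      module
    · simp [hE]
  rw [e, trace_tensorOp_mul_re_eq_momentFunctional Ψ α β ρ hm, Fin.prod_univ_castSucc]
  congr 2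
  · have e2 (j : Fin N) : C (β j.castSucc) * X + C (α j.castSucc)
        = (fun r : ℕ => if r < N - i then C lam * X + C 1 else C (1 - lam) * X + C 0) j := by
      simp only [α, β, Fin.val_castSucc, j.isLt, if_true]
      split_ifs <;> rfl
    rw [Finset.prod_congr rfl fun j _ => e2 j, Fin.prod_univ_eq_prod_range
      (fun r : ℕ => if r < N - i then C lam * X + C 1 else C (1 - lam) * X + C 0)]
    obtain ⟨l, rfl⟩ := Nat.exists_eq_add_of_le' hi
    rw [Nat.add_sub_cancel, Finset.prod_range_add]
    congr 1
    · rw [Finset.prod_congr rfl fun r hr => if_pos (Finset.mem_range.1 hr), Finset.prod_const,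
        Finset.card_range]
    · rw [Finset.prod_congr rfl fun r _ => if_neg (by omega), Finset.prod_const,
        Finset.card_range]
  · simp [α, β]

/-- The untested system adds a factor b X + 1; b = 1 yields the acceptance probability and b = 0 the
fidelity weight. -/
lemma acceptWeight_eq_momentFunctional (Ψ : EuclideanSpace ℂ ι) (lam : ℝ) (k N : ℕ)
    (ρ : Matrix (Fin (N + 1) → ι) (Fin (N + 1) → ι) ℂ) {m : ℕ → ℝ}
    (hm : ∀ S : Finset (Fin (N + 1)), patternProb Ψ ρ S = m S.card)
    {E : Matrix ι ι ℂ} {b : ℝ} (hE : E = proj Ψ + (b : ℂ) • (1 - proj Ψ)) :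
    acceptWeight Ψ lam k N E ρ
      = ∑ j ∈ Finset.range (N + 1),
        (N.choose j : ℝ) * binomialCdf lam k j * (m j + b * m (j + 1)) := by
  have hterm (i : ℕ) : (N.choose i : ℝ) * ((testOp Ψ lam N i E * ρ).trace).re
      = ∑ j ∈ Finset.range (N + 1),
        (N.choose j : ℝ) * binomialWeight lam j i * (m j + b * m (j + 1)) := by
    rcases le_or_gt i N with hi | hi
    · rw [trace_testOp_mul_re Ψ lam hi ρ hm hE, ← smul_eq_mul, ← map_smul, smul_eq_C_mul,
        ← mul_assoc, choose_mul_passPoly lam hi, Finset.sum_mul, map_sum]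
      refine Finset.sum_congr rfl fun j _ => ?_
      have e (c : ℝ) : C c * X ^ j * (C b * X + C 1)
          = C c * X ^ j + C (c * b) * X ^ (j + 1) := by
        rw [C_mul, C_1]
        ring
      rw [e, map_add, momentFunctional_C_mul_X_pow, momentFunctional_C_mul_X_pow]
      ring
    · rw [Nat.choose_eq_zero_of_lt hi, Nat.cast_zero, zero_mul, Finset.sum_eq_zero]
      intro j hj
      have := Finset.mem_range.1 hj
      rw [binomialWeight_eq_zero (by omega), mul_zero, zero_mul]
  unfold acceptWeight
  rw [Finset.sum_congr rfl fun i _ => hterm i, Finset.sum_comm]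
  refine Finset.sum_congr rfl fun j _ => ?_
  rw [← Finset.sum_mul, ← Finset.mul_sum]
  rfl

/-- The statistics of a permutation-invariant state: `m j` is the probability of each pattern of
`j` erroneous systems. -/
lemma exists_patternProb {n : ℕ} {Ψ : EuclideanSpace ℂ ι} (hΨ : ‖Ψ‖ = 1)
    {ρ : Matrix (Fin n → ι) (Fin n → ι) ℂ} (hρ : IsDensityOp ρ) (hinv : IsPermInvariant ρ) :
    ∃ m : ℕ → ℝ, (∀ S : Finset (Fin n), patternProb Ψ ρ S = m S.card) ∧ (∀ j, 0 ≤ m j) ∧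
      ∑ j ∈ Finset.range (n + 1), (n.choose j : ℝ) * m j = 1 := by
  classical
  let m : ℕ → ℝ := fun j =>
    if h : ∃ S : Finset (Fin n), S.card = j then patternProb Ψ ρ h.choose else 0
  have hm (S : Finset (Fin n)) : patternProb Ψ ρ S = m S.card := by
    have h : ∃ T : Finset (Fin n), T.card = S.card := ⟨S, rfl⟩
    simp only [m, dif_pos h]
    exact patternProb_eq_of_card_eq Ψ hinv h.choose_spec.symm
  refine ⟨m, hm, fun j => ?_, ?_⟩
  · simp only [m]
    split_ifs
    · exact patternProb_nonneg hΨ hρ.1 _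
    · exact le_rfl
  -- Normalisation: the identity operator corresponds to the polynomial (X + 1) ^ n.
  · have h := trace_tensorOp_mul_re_eq_momentFunctional Ψ (fun _ => 1) (fun _ => 1) ρ hm
    simp only [Complex.ofReal_one, one_smul, add_sub_cancel, tensorOp_one, one_mul, hρ.2,
      Complex.one_re, C_1, Finset.prod_const, Finset.card_univ, Fintype.card_fin, add_pow, one_pow,
      mul_one, map_sum] at h
    rw [h]
    refine Finset.sum_congr rfl fun j _ => ?_
    rw [← momentFunctional_C_mul_X_pow, map_natCast, mul_comm]

end Statistics

/-! ### From the supporting line to the guaranteed infidelity -/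

/-- Among j errors in N + 1 systems, the last system is erroneous with probability j / (N + 1); both
absorption identities for binomial coefficients express this. -/
lemma sum_choose_mul_excess (lam : ℝ) (k N : ℕ) (η : ℝ) (m : ℕ → ℝ) :
    ∑ j ∈ Finset.range (N + 2), ((N + 1).choose j : ℝ) * m j * excess lam k N η j
      = (N + 1) * ∑ j ∈ Finset.range (N + 1), (N.choose j : ℝ) * binomialCdf lam k j
          * ((1 - η) * m (j + 1) - η * m j) := by
  have e1 : ∑ j ∈ Finset.range (N + 2), ((N + 1).choose j : ℝ) * m j
        * (j * binomialCdf lam k (j - 1))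
      = (N + 1) * ∑ j ∈ Finset.range (N + 1), (N.choose j : ℝ) * binomialCdf lam k j * m (j + 1) := by
    rw [Finset.sum_range_succ', Finset.mul_sum]
    simp only [Nat.cast_zero, zero_mul, mul_zero, add_zero]
    refine Finset.sum_congr rfl fun j _ => ?_
    have h : ((N : ℝ) + 1) * N.choose j = (N + 1).choose (j + 1) * ((j : ℝ) + 1) := by
      exact_mod_cast Nat.add_one_mul_choose_eq N j
    rw [Nat.add_sub_cancel]
    push_cast
    linear_combination (-(m (j + 1) * binomialCdf lam k j)) * h
  have e2 : ∑ j ∈ Finset.range (N + 2), ((N + 1).choose j : ℝ) * m j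
        * (((N : ℝ) + 1 - j) * binomialCdf lam k j)
      = (N + 1) * ∑ j ∈ Finset.range (N + 1), (N.choose j : ℝ) * binomialCdf lam k j * m j := by
    rw [Finset.sum_range_succ, Finset.mul_sum]
    push_cast
    rw [sub_self, zero_mul, mul_zero, add_zero]
    refine Finset.sum_congr rfl fun j hj => ?_
    have hj' : j ≤ N := Nat.lt_succ_iff.1 (Finset.mem_range.1 hj)
    have h : ((N + 1).choose j : ℝ) * ((N : ℝ) + 1 - j) = N.choose j * (N + 1) := by
      have := Nat.choose_mul_succ_eq N j
      have e : ((N + 1 - j : ℕ) : ℝ) = (N : ℝ) + 1 - j := by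
        rw [Nat.cast_sub (by omega)]
        push_cast
        rfl
      rw [← e]
      exact_mod_cast this.symm
    linear_combination (m j * binomialCdf lam k j) * h
  calc _ = (1 - η) * ∑ j ∈ Finset.range (N + 2), ((N + 1).choose j : ℝ) * m j
            * (j * binomialCdf lam k (j - 1))
          - η * ∑ j ∈ Finset.range (N + 2), ((N + 1).choose j : ℝ) * m j
            * (((N : ℝ) + 1 - j) * binomialCdf lam k j) := by
        rw [Finset.mul_sum, Finset.mul_sum, ← Finset.sum_sub_distrib]
        refine Finset.sum_congr rfl fun j _ => ?_
        rw [excess]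
        ring
    _ = _ := by
        rw [e1, e2, Finset.mul_sum, Finset.mul_sum, Finset.mul_sum, Finset.mul_sum, Finset.mul_sum,
          ← Finset.sum_sub_distrib]
        refine Finset.sum_congr rfl fun j _ => ?_
        ring

section GuaranteedInfidelity

variable {ι : Type*} [DecidableEq ι]

lemma isDensityOp_patternOp_empty [Fintype ι] {Ψ : EuclideanSpace ℂ ι} (hΨ : ‖Ψ‖ = 1) (n : ℕ) :
    IsDensityOp (patternOp Ψ (∅ : Finset (Fin n))) := by
  refine ⟨posSemidef_patternOp hΨ _, ?_⟩
  simp [patternOp, trace_tensorOp, trace_proj hΨ]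

lemma isPermInvariant_patternOp_empty (Ψ : EuclideanSpace ℂ ι) (n : ℕ) :
    IsPermInvariant (patternOp Ψ (∅ : Finset (Fin n))) := by
  intro σ x y
  simp only [patternOp, tensorOp, Matrix.of_apply, Function.comp_apply, Finset.notMem_empty,
    if_false]
  exact Equiv.prod_comp σ fun j => proj Ψ (x j) (y j)

variable [Fintype ι]

lemma acceptProb_eq (Ψ : EuclideanSpace ℂ ι) (lam : ℝ) (k N : ℕ)
    (ρ : Matrix (Fin (N + 1) → ι) (Fin (N + 1) → ι) ℂ) {m : ℕ → ℝ}
    (hm : ∀ S : Finset (Fin (N + 1)), patternProb Ψ ρ S = m S.card) :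
    acceptProb Ψ lam k N ρ
      = ∑ j ∈ Finset.range (N + 1),
        (N.choose j : ℝ) * binomialCdf lam k j * (m j + m (j + 1)) := by
  rw [acceptProb, acceptWeight_eq_momentFunctional Ψ lam k N ρ hm (b := 1) (by simp)]
  simp only [one_mul]

/-- The target state is accepted with certainty. -/
lemma one_le_acceptProb_patternOp_empty {Ψ : EuclideanSpace ℂ ι} (hΨ : ‖Ψ‖ = 1) {lam : ℝ}
    (h0 : 0 < lam) (h1 : lam < 1) (k N : ℕ) :
    1 ≤ acceptProb Ψ lam k N (patternOp Ψ (∅ : Finset (Fin (N + 1)))) := by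
  obtain ⟨m, hm, hmnn, -⟩ := exists_patternProb hΨ (isDensityOp_patternOp_empty hΨ (N + 1))
    (isPermInvariant_patternOp_empty Ψ (N + 1))
  have hm0 : m 0 = 1 := by
    rw [← Finset.card_empty (α := Fin (N + 1)), ← hm, patternProb, patternOp_mul_self hΨ,
      (isDensityOp_patternOp_empty hΨ (N + 1)).2, Complex.one_re]
  rw [acceptProb_eq Ψ lam k N _ hm]
  have hnn (j : ℕ) : 0 ≤ (N.choose j : ℝ) * binomialCdf lam k j * (m j + m (j + 1)) :=
    mul_nonneg (mul_nonneg (Nat.cast_nonneg _) (binomialCdf_pos h0 h1 k j).le)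
      (add_nonneg (hmnn _) (hmnn _))
  refine le_trans ?_ (Finset.single_le_sum (fun j _ => hnn j)
    (Finset.mem_range.2 (Nat.succ_pos N)))
  have := hmnn 1
  rw [binomialCdf_zero, Nat.choose_zero_right, hm0, Nat.cast_one, one_mul, one_mul]
  linarith

/-- A supporting line gives a bound on the guaranteed infidelity. -/
lemma guaranteedInfidelity_le_of_excess_le {Ψ : EuclideanSpace ℂ ι} (hΨ : ‖Ψ‖ = 1) {lam : ℝ}
    (h0 : 0 < lam) (h1 : lam < 1) {k N : ℕ} {ε δ η : ℝ} (hδ0 : 0 < δ) (hδ1 : δ ≤ 1) (hη : η ≤ ε)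
    (hex : ∀ j ≤ N + 1, excess lam k N η j ≤ (N + 1) * ((ε - η) * δ)) :
    guaranteedInfidelity Ψ lam k N δ ≤ ε := by
  unfold guaranteedInfidelity
  rw [sub_le_comm]
  -- The infimum of an empty real set would be 0, so feasibility matters; the pure target state
  -- provides it.
  refine le_csInf ⟨_, patternOp Ψ ∅, isDensityOp_patternOp_empty hΨ (N + 1),
    isPermInvariant_patternOp_empty Ψ (N + 1),
    hδ1.trans (one_le_acceptProb_patternOp_empty hΨ h0 h1 k N), rfl⟩ ?_
  rintro F ⟨ρ, hρ, hinv, hp, rfl⟩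
  obtain ⟨m, hm, hmnn, hsum⟩ := exists_patternProb hΨ hρ hinv
  have hppos : 0 < acceptProb Ψ lam k N ρ := hδ0.trans_le hp
  rw [condFidelity, le_div_iff₀ hppos]
  have hf : acceptWeight Ψ lam k N (proj Ψ) ρ
      = ∑ j ∈ Finset.range (N + 1), (N.choose j : ℝ) * binomialCdf lam k j * m j := by
    rw [acceptWeight_eq_momentFunctional Ψ lam k N ρ hm (b := 0) (by simp)]
    simp only [zero_mul, add_zero]
  have hpe := acceptProb_eq Ψ lam k N ρ hm
  have hkey : ((N : ℝ) + 1) * ((1 - η) * acceptProb Ψ lam k N ρ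
      - acceptWeight Ψ lam k N (proj Ψ) ρ) ≤ (N + 1) * ((ε - η) * δ) := by
    calc ((N : ℝ) + 1) * ((1 - η) * acceptProb Ψ lam k N ρ
          - acceptWeight Ψ lam k N (proj Ψ) ρ)
        = ∑ j ∈ Finset.range (N + 2), ((N + 1).choose j : ℝ) * m j * excess lam k N η j := by
          rw [sum_choose_mul_excess, hf, hpe, Finset.mul_sum, ← Finset.sum_sub_distrib]
          congr 1
          refine Finset.sum_congr rfl fun j _ => ?_
          ring
      _ ≤ ∑ j ∈ Finset.range (N + 2), ((N + 1).choose j : ℝ) * m j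
            * ((N + 1) * ((ε - η) * δ)) := by
          refine Finset.sum_le_sum fun j hj => mul_le_mul_of_nonneg_left (hex j ?_)
            (mul_nonneg (Nat.cast_nonneg _) (hmnn j))
          have := Finset.mem_range.1 hj
          omega
      _ = _ := by rw [← Finset.sum_mul, hsum, one_mul]
  have h2 := le_of_mul_le_mul_left hkey (by positivity)
  have h3 : (ε - η) * δ ≤ (ε - η) * acceptProb Ψ lam k N ρ :=
    mul_le_mul_of_nonneg_left hp (by linarith)
  linarith

lemma guaranteedInfidelity_le {Ψ : EuclideanSpace ℂ ι} (hΨ : ‖Ψ‖ = 1) {lam : ℝ}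
    (h0 : 0 < lam) (h1 : lam < 1) {s ε δ : ℝ} (hs : 0 ≤ s) (hsε : s < ε) (hε : ε < 1)
    (hδ0 : 0 < δ) (hδ : δ ≤ 1 / 2) {N : ℕ}
    (hN : ε / (lam * (1 - lam) * (ε - s)) ^ 2 * (Real.log δ⁻¹ + 4 * lam * (1 - lam) ^ 2) ≤ (N : ℝ)) :
    guaranteedInfidelity Ψ lam ⌊(1 - lam) * s * N⌋₊ N δ ≤ ε := by
  have hν : 0 < 1 - lam := by linarith
  have hε0 : 0 < ε := hs.trans_lt hsε
  have hd : 0 < ε - s := sub_pos.2 hsε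
  have hlog : 0 < Real.log δ⁻¹ := Real.log_pos ((one_lt_inv₀ hδ0).2 (by linarith))
  have hT : 0 < Real.log δ⁻¹ + 4 * lam * (1 - lam) ^ 2 := by positivity
  have hNpos : (0 : ℝ) < N := lt_of_lt_of_le (by positivity) hN
  set k := ⌊(1 - lam) * s * N⌋₊ with hk
  have hkle : (k : ℝ) ≤ (1 - lam) * s * N := Nat.floor_le (by positivity)
  have hDge : (ε - s) * N ≤ ε * N - k / (1 - lam) := by
    have : k / (1 - lam) ≤ s * N := by
      rw [div_le_iff₀ hν]
      linarith
    linarith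
  have hDpos : 0 < (ε - s) * N := by positivity
  -- D is defined from k itself, so the floor only makes it larger than (ε - s) N.
  obtain ⟨n, hkn, hnN, hB, hinf, hhaz⟩ := exists_threshold h0 h1 (k := k) (N := N) hε0 hε hδ0 hδ
    (D := ε * N - k / (1 - lam)) (hDpos.trans_le hDge) (by field_simp; ring) (by
      have h2 : (lam * (1 - lam) * ((ε - s) * N)) ^ 2
          ≤ (lam * (1 - lam) * (ε * N - k / (1 - lam))) ^ 2 := by gcongr
      refine le_trans ?_ h2
      rw [div_mul_eq_mul_div, div_le_iff₀ (by positivity)] at hN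
      have h3 := mul_le_mul_of_nonneg_left hN hNpos.le
      calc _ = N * (ε * (Real.log δ⁻¹ + 4 * lam * (1 - lam) ^ 2)) := by ring
        _ ≤ _ := h3
        _ = _ := by ring)
  obtain ⟨η, hη, hex⟩ := exists_supporting_line h0 h1 hkn hnN hB hinf hhaz
  exact guaranteedInfidelity_le_of_excess_le hΨ h0 h1 hδ0 (by linarith) hη hex

end GuaranteedInfidelity

end StateVerification

end

/-! ### Sampling cost -/

theorem theorem2 (lam : ℝ) (hlam0 : 0 < lam) (hlam1 : lam < 1) :
    (∀ {ι : Type*} [Fintype ι] [DecidableEq ι] (Ψ : EuclideanSpace ℂ ι), ‖Ψ‖ = 1 →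
      ∀ s ε δ : ℝ, 0 ≤ s → s < ε → ε < 1 → 0 < δ → δ ≤ 1 / 2 →
      ∀ N : ℕ,
        ε / (lam * (1 - lam) * (ε - s)) ^ 2 * (Real.log δ⁻¹ + 4 * lam * (1 - lam) ^ 2) ≤ (N : ℝ) →
        StateVerification.guaranteedInfidelity Ψ lam ⌊(1 - lam) * s * N⌋₊ N δ ≤ ε) ∧
    (∀ c : ℝ, 0 ≤ c → c < 1 →
      ∃ C : ℝ, 0 < C ∧ ∀ s ε δ : ℝ, 0 < ε → ε < 1 → s / ε = c → 0 < δ → δ ≤ 1 / 2 →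
        ∃ N₀ : ℕ, 1 ≤ N₀ ∧ (N₀ : ℝ) ≤ C * (ε⁻¹ * Real.log δ⁻¹) ∧
          ∀ {ι : Type*} [Fintype ι] [DecidableEq ι] (Ψ : EuclideanSpace ℂ ι), ‖Ψ‖ = 1 →
            ∀ N : ℕ, N₀ ≤ N →
              StateVerification.guaranteedInfidelity Ψ lam ⌊(1 - lam) * s * N⌋₊ N δ ≤ ε) := by
  refine ⟨fun Ψ hΨ s ε δ hs hsε hε hδ0 hδ N hN =>
    StateVerification.guaranteedInfidelity_le hΨ hlam0 hlam1 hs hsε hε hδ0 hδ hN,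
    fun c hc0 hc1 => ?_⟩
  have hν : 0 < 1 - lam := by linarith
  have hc : 0 < 1 - c := by linarith
  have hl2 : 0 < Real.log 2 := Real.log_pos one_lt_two
  set a := 4 * lam * (1 - lam) ^ 2 with ha
  have ha0 : 0 < a := by positivity
  set K := 1 / (lam * (1 - lam) * (1 - c)) ^ 2 with hK
  have hK0 : 0 < K := by positivity
  -- As log δ⁻¹ ≥ log 2 and ε⁻¹ ≥ 1, the summand a / log 2 absorbs a, and the last summand absorbs
  -- the 1 lost by rounding N₀ up.
  refine ⟨K * (1 + a / Real.log 2) + 1 / Real.log 2, by positivity, ?_⟩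
  intro s ε δ hε0 hε hsc hδ0 hδ
  have hs : s = c * ε := by rw [← hsc]; field_simp
  have hlog : Real.log 2 ≤ Real.log δ⁻¹ := Real.log_le_log two_pos
    (by rw [le_inv_comm₀ two_pos hδ0]; linarith)
  have hlog0 : 0 < Real.log δ⁻¹ := hl2.trans_le hlog
  have hinv : 1 ≤ ε⁻¹ := (one_le_inv₀ hε0).2 hε.le
  have hval : ε / (lam * (1 - lam) * (ε - s)) ^ 2 * (Real.log δ⁻¹ + a)
      = K * ε⁻¹ * (Real.log δ⁻¹ + a) := by
    have e : ε - s = ε * (1 - c) := by rw [hs]; ring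
    rw [e, hK]
    field_simp
  have hpos : 0 < K * ε⁻¹ * (Real.log δ⁻¹ + a) := by positivity
  refine ⟨⌈K * ε⁻¹ * (Real.log δ⁻¹ + a)⌉₊, Nat.one_le_iff_ne_zero.2 (Nat.ceil_pos.2 hpos).ne',
    (Nat.ceil_lt_add_one hpos.le).le.trans ?_, ?_⟩
  · have e1 : a ≤ a / Real.log 2 * Real.log δ⁻¹ := by
      rw [div_mul_eq_mul_div, le_div_iff₀ hl2]
      gcongr
    have e2 : 1 ≤ 1 / Real.log 2 * (ε⁻¹ * Real.log δ⁻¹) := by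
      rw [div_mul_eq_mul_div, le_div_iff₀ hl2, one_mul, one_mul]
      exact hlog.trans (le_mul_of_one_le_left hlog0.le hinv)
    calc K * ε⁻¹ * (Real.log δ⁻¹ + a) + 1
        ≤ K * ε⁻¹ * (Real.log δ⁻¹ + a / Real.log 2 * Real.log δ⁻¹)
          + 1 / Real.log 2 * (ε⁻¹ * Real.log δ⁻¹) := by gcongr
      _ = _ := by ring
  · intro ι _ _ Ψ hΨ N hN
    refine StateVerification.guaranteedInfidelity_le hΨ hlam0 hlam1 (s := s) ?_ ?_ hε hδ0 hδ ?_
    · rw [hs]; positivity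
    · rw [hs]; exact mul_lt_of_lt_one_left hε0 hc1
    · rw [hval]
      exact (Nat.le_ceil _).trans (Nat.cast_le.2 hN)
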